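/- Let $n\ge 2$, let $u\in\mathbb{R}^n$ be a unit vector, and let $H=u^{\perp}$ be oriented so that $u$ lies in the closed half-space $H^+=\{x: x\cdot u\ge 0\}$; put $H^-=\{x:x\cdot u\le 0\}$. Let $x^{\dagger}$ and $A^{\dagger}$ denote the reflections in $H$ of a point $x$ and of a set $A$. Let $\mathcal{K}^n$ be the class of nonempty compact convex subsets of $\mathbb{R}^n$, $\mathcal{K}^n_n$ the class of those with nonempty interior, and $\mathcal{L}^n$ the class of Lebesgue measurable subsets of $\mathbb{R}^n$ of finite measure. "Essentially" means up to Lebesgue null sets, and $B(x,r)$ is the closed ball with center $x$ and radius $r$. For $A\subset\mathbb{R}^n$ let $\Diamond_{P_H}A=\{x: (P_H1_A)(x)=1\}$, where $P_Hf(x)=\max\{f(x),f(x^\dagger)\}$ if $x\in H^+$ and $P_Hf(x)=\min\{f(x),f(x^\dagger)\}$ if $x\in H^-$, and let $\Diamond_{P_H}^{\dagger}A=(\Diamond_{P_H}A)^{\dagger}$. Let $\mathcal{E}=\mathcal{K}^n_n$ or $\mathcal{E}=\mathcal{K}^n$, and suppose that $\Diamond:\mathcal{E}\to\mathcal{L}^n$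 has the following properties for all $K,L\in\mathcal{E}$, where all inclusions and equalities of sets are understood essentially: - (monotonic) $K\subset L$ implies $\Diamond K\subset\Diamond L$; - (measure preserving) $\Diamond K$ and $K$ have the same measure; - (respects $H$-cylinders) if $x\in\mathbb{R}^n$, $r>0$ and $K\subset (B(x,r)\cap H)+H^{\perp}$, then $\Diamond K\subset (B(x,r)\cap H)+H^{\perp}$; - (maps balls to balls) if $K=B(x,r)$ with $r>0$, then $\Diamond K=B(x',r')$ for some $x'\in\mathbb{R}^n$ and $r'>0$. Then there is a unique function $\varphi_{\Diamond}:\mathbb{R}\to\mathbb{R}$ that is Lipschitz with constant $1$ and satisfies $\Diamond B(x+tu,r)=B(x+\varphi_{\Diamond}(t)u,r)$, essentially, for all $x\in H$, $t\in\mathbb{R}$ and $r>0$. Moreover: 1. $\varphi_{\Diamond}(t)=t$ for all $t\in\mathbb{R}$ if and only if $\Diamond K=K$, essentially, for every $K\in\mathcal{E}$; 2. $\varphi_{\Diamond}(t)=-t$ for all $t\in\mathbb{R}$ if and only if $\Diamond K=K^{\dagger}$, essentially, for every $K\in\mathcal{E}$; 3. $\varphi_{\Diamond}(t)=|t|$ for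 all $t\in\mathbb{R}$ if and only if $\Diamond K=\Diamond_{P_H}K$, essentially, for every $K\in\mathcal{E}$; 4. $\varphi_{\Diamond}(t)=-|t|$ for all $t\in\mathbb{R}$ if and only if $\Diamond K=\Diamond_{P_H}^{\dagger}K$, essentially, for every $K\in\mathcal{E}$. -/

import Mathlib

open MeasureTheory
open scoped Pointwise

noncomputable section

namespace Polarization

/-- Euclidean `n`-space. -/
abbrev Euc (n : ℕ) : Type := EuclideanSpace ℝ (Fin n)

/-- Nonempty compact convex subsets of `ℝⁿ`. -/
def compactConvexSets (n : ℕ) : Set (Set (Euc n)) :=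
  {K | K.Nonempty ∧ IsCompact K ∧ Convex ℝ K}

/-- Convex bodies: nonempty compact convex sets with interior points. -/
def convexBodies (n : ℕ) : Set (Set (Euc n)) :=
  {K | K ∈ compactConvexSets n ∧ (interior K).Nonempty}

/-- Lebesgue measurable subsets of `ℝⁿ` of finite measure. -/
def finiteMeasureSets (n : ℕ) : Set (Set (Euc n)) :=
  {A | NullMeasurableSet A volume ∧ volume A < ⊤}

/-- The hyperplane `H = u^⊥`. -/
abbrev hyperplane {n : ℕ} (u : Euc n) : Submodule ℝ (Euc n) := (Submodule.span ℝ {u})ᗮ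

/-- The reflection `A†` of the set `A` in the subspace `H`. -/
def reflectSet {n : ℕ} (H : Submodule ℝ (Euc n)) (A : Set (Euc n)) : Set (Euc n) :=
  H.reflection '' A

/-- Polarization `P_H f` of a function `f`, where `H = u^⊥` is oriented with `u ∈ H⁺`. On `H`
itself `x† = x`, so both branches agree there. -/
def polarize {n : ℕ} (u : Euc n) (f : Euc n → ℝ) (x : Euc n) : ℝ :=
  if 0 ≤ inner ℝ u x then max (f x) (f ((hyperplane u).reflection x))
  else min (f x) (f ((hyperplane u).reflection x))

/-- The set map induced by polarization: `A ↦ {x | (P_H 1_A)(x) = 1}`. -/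
def polarizeSet {n : ℕ} (u : Euc n) (A : Set (Euc n)) : Set (Euc n) :=
  {x | polarize u (A.indicator (fun _ => (1 : ℝ))) x = 1}

section Properties

variable {n : ℕ} {𝓔 : Set (Set (Euc n))}

/-- `K ⊆ L ⇒ D K ⊆ D L`, inclusions up to null sets. -/
def IsMonotonic (D : 𝓔 → finiteMeasureSets n) : Prop :=
  ∀ K L : 𝓔, (K : Set (Euc n)) ≤ᵐ[volume] (L : Set (Euc n)) →
    (D K : Set (Euc n)) ≤ᵐ[volume] (D L : Set (Euc n))

def IsMeasurePreserving (D : 𝓔 → finiteMeasureSets n) : Prop :=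
  ∀ K : 𝓔, volume (D K : Set (Euc n)) = volume (K : Set (Euc n))

/-- If `K ⊆ (B(x,r) ∩ H) + H^⊥`, then `D K ⊆ (B(x,r) ∩ H) + H^⊥`, up to null sets. -/
def RespectsCylinders (H : Submodule ℝ (Euc n)) (D : 𝓔 → finiteMeasureSets n) : Prop :=
  ∀ (K : 𝓔) (x : Euc n) (r : ℝ), 0 < r →
    (K : Set (Euc n)) ≤ᵐ[volume]
      ((Metric.closedBall x r ∩ (H : Set (Euc n))) + (Hᗮ : Set (Euc n)) : Set (Euc n)) →
    (D K : Set (Euc n)) ≤ᵐ[volume]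
      ((Metric.closedBall x r ∩ (H : Set (Euc n))) + (Hᗮ : Set (Euc n)) : Set (Euc n))

/-- The image of every ball is a ball, up to null sets. -/
def MapsBallsToBalls (D : 𝓔 → finiteMeasureSets n) : Prop :=
  ∀ (K : 𝓔) (x : Euc n) (r : ℝ), 0 < r →
    (K : Set (Euc n)) =ᵐ[volume] Metric.closedBall x r →
    ∃ (x' : Euc n) (r' : ℝ), 0 < r' ∧
      (D K : Set (Euc n)) =ᵐ[volume] Metric.closedBall x' r'

/-- `φ` is a contraction with `D B(x + t u, r) = B(x + φ(t) u, r)` up to null sets, for all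
`r > 0`, `x ∈ H = u^⊥` and `t ∈ ℝ`. -/
def IsShiftFunction (u : Euc n) (D : 𝓔 → finiteMeasureSets n) (φ : ℝ → ℝ) : Prop :=
  LipschitzWith 1 φ ∧
    ∀ (K : 𝓔) (x : Euc n) (t r : ℝ), x ∈ hyperplane u → 0 < r →
      (K : Set (Euc n)) = Metric.closedBall (x + t • u) r →
      (D K : Set (Euc n)) =ᵐ[volume] Metric.closedBall (x + φ t • u) r

/-- `D` agrees with the set map `F` up to null sets (the null set may depend on the argument). -/
def EssentiallyEquals (D : 𝓔 → finiteMeasureSets n) (F : Set (Euc n) → Set (Euc n)) : Prop :=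
  ∀ K : 𝓔, (D K : Set (Euc n)) =ᵐ[volume] F K

end Properties

end Polarization

end

/-! On balls, `D` keeps the radius by measure preservation and keeps the projection of the centre to
`H` because cylinders are respected; it can only move the centre along `u`. Monotonicity applied to
internally tangent balls whose centres have the same height shows that the new height depends on the
old height alone. Having `n ≥ 2` matters here: radii at one centre are compared by a detour through
a horizontally displaced ball.

The function `φ` then determines `D K` along segments parallel to `u`. A cylinder of small radius
`δ` around a segment of half-length `h` in the interior of `K` lies in a ball of radius `h +
δ²/(2h)`. Its image therefore lies in a cylinder of the same radius, with centre moved by `φ` and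
half-height enlarged by only `δ²/(2h)`. Measure preservation leaves a defect of order `δ^(n+1)`,
negligible against the volume `δ^n` of a ball, so interior points of the moved segment are density
points of `D K` (`tendsto_volume_closedBall_sdiff`).

If every point of a set `G` arises in this way and `G` has at least the volume of `K`, the density
theorem and a comparison of volumes give `D K = G` essentially (`image_ae_eq_of_segments`). The four
set maps are instances. For polarization, a point whose mirror image also lies in the set is reached
by a segment centred on `H`, as `φ 0 = 0`. Conversely, unit balls centred on `ℝ u` reveal `φ`. -/

namespace Polarization

open MeasureTheory Metric Set Filter Topology
open scoped Pointwise

/-! ### Decomposition along `u` and its orthogonal complement. -/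

section Geometry

variable {n : ℕ} {u : Euc n}

theorem mem_hyperplane_iff {x : Euc n} : x ∈ hyperplane u ↔ inner ℝ u x = 0 :=
  Submodule.mem_orthogonal_singleton_iff_inner_right

theorem inner_self_of_norm_eq_one (hu : ‖u‖ = 1) : inner ℝ u u = 1 := by
  rw [real_inner_self_eq_norm_sq, hu, one_pow]

theorem reflection_hyperplane_apply (hu : ‖u‖ = 1) (z : Euc n) :
    (hyperplane u).reflection z = z - (2 * inner ℝ u z) • u := by
  rw [Submodule.reflection_orthogonal_apply, Submodule.reflection_singleton_apply, hu]
  simp only [RCLike.ofReal_real_eq_id, id, one_pow, div_one]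
  module

theorem inner_reflection (hu : ‖u‖ = 1) (z : Euc n) :
    inner ℝ u ((hyperplane u).reflection z) = -inner ℝ u z := by
  rw [reflection_hyperplane_apply hu, inner_sub_right, inner_smul_right,
    inner_self_of_norm_eq_one hu]
  ring

/-- The component of `z` orthogonal to `u`, for a unit vector `u`. -/
noncomputable def perpPart (u : Euc n) : Euc n →L[ℝ] Euc n :=
  ContinuousLinearMap.id ℝ (Euc n) - (innerSL ℝ u).smulRight u

theorem perpPart_apply (u z : Euc n) : perpPart u z = z - (inner ℝ u z) • u := by
  simp [perpPart]

theorem perpPart_add_smul (u z : Euc n) : perpPart u z + (inner ℝ u z) • u = z := by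
  simp [perpPart_apply]

theorem inner_perpPart (hu : ‖u‖ = 1) (z : Euc n) : inner ℝ u (perpPart u z) = 0 := by
  rw [perpPart_apply, inner_sub_right, inner_smul_right, inner_self_of_norm_eq_one hu]
  ring

theorem perpPart_mem (hu : ‖u‖ = 1) (z : Euc n) : perpPart u z ∈ hyperplane u :=
  mem_hyperplane_iff.2 (inner_perpPart hu z)

theorem perpPart_eq_self {x : Euc n} (hx : x ∈ hyperplane u) : perpPart u x = x := by
  rw [perpPart_apply, mem_hyperplane_iff.1 hx]; simp

theorem perpPart_smul_self (hu : ‖u‖ = 1) (t : ℝ) : perpPart u (t • u) = 0 := by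
  rw [perpPart_apply, inner_smul_right, inner_self_of_norm_eq_one hu]; simp

theorem inner_add_smul (hu : ‖u‖ = 1) {x : Euc n} (hx : x ∈ hyperplane u) (t : ℝ) :
    inner ℝ u (x + t • u) = t := by
  rw [inner_add_right, inner_smul_right, inner_self_of_norm_eq_one hu, mem_hyperplane_iff.1 hx]
  ring

theorem norm_sq_eq_perpPart (hu : ‖u‖ = 1) (z : Euc n) :
    ‖z‖ ^ 2 = ‖perpPart u z‖ ^ 2 + (inner ℝ u z) ^ 2 := by
  have h : inner ℝ (perpPart u z) ((inner ℝ u z) • u) = 0 := by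
    rw [inner_smul_right, real_inner_comm u (perpPart u z), inner_perpPart hu, mul_zero]
  have := norm_add_sq_eq_norm_sq_add_norm_sq_of_inner_eq_zero _ _ h
  rw [perpPart_add_smul, norm_smul, hu] at this
  simp only [Real.norm_eq_abs, mul_one, abs_mul_abs_self] at this
  nlinarith

theorem norm_perpPart_le (hu : ‖u‖ = 1) (z : Euc n) : ‖perpPart u z‖ ≤ ‖z‖ := by
  have := norm_sq_eq_perpPart hu z
  exact pow_le_pow_iff_left₀ (norm_nonneg _) (norm_nonneg _) two_ne_zero |>.1 (by
    nlinarith [sq_nonneg (inner ℝ u z)])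

theorem abs_inner_le (hu : ‖u‖ = 1) (z : Euc n) : |inner ℝ u z| ≤ ‖z‖ := by
  simpa [hu] using abs_real_inner_le_norm u z

theorem exists_ne_zero_mem_hyperplane (hn : 2 ≤ n) (u : Euc n) :
    ∃ v ∈ hyperplane u, v ≠ 0 := by
  apply Submodule.exists_mem_ne_zero_of_ne_bot
  intro h
  have h1 := Submodule.finrank_add_finrank_orthogonal (Submodule.span ℝ {u})
  have h2 : Module.finrank ℝ (Submodule.span ℝ {u}) ≤ 1 := by
    simpa using finrank_span_le_card (R := ℝ) ({u} : Set (Euc n))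
  change (Submodule.span ℝ {u})ᗮ = ⊥ at h
  rw [h, finrank_bot, finrank_euclideanSpace_fin] at h1
  omega

/-- The `H`-cylinder over a disc consists of the points whose orthogonal part lies in the disc. -/
theorem mem_cylinder_iff (hu : ‖u‖ = 1) {x z : Euc n} {r : ℝ} :
    z ∈ (closedBall x r ∩ (hyperplane u : Set (Euc n))) + ((hyperplane u)ᗮ : Set (Euc n)) ↔
      perpPart u z ∈ closedBall x r := by
  have hspan : (hyperplane u)ᗮ = Submodule.span ℝ {u} := Submodule.orthogonal_orthogonal _
  rw [hspan, Set.mem_add]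
  constructor
  · rintro ⟨a, ⟨ha, haH⟩, b, hb, rfl⟩
    obtain ⟨t, rfl⟩ := Submodule.mem_span_singleton.1 hb
    rwa [map_add, perpPart_smul_self hu, add_zero, perpPart_eq_self haH]
  · intro h
    exact ⟨_, ⟨h, perpPart_mem hu z⟩, _, Submodule.mem_span_singleton.2 ⟨inner ℝ u z, rfl⟩,
      perpPart_add_smul u z⟩

theorem isClosed_cylinder (hu : ‖u‖ = 1) (x : Euc n) (r : ℝ) :
    IsClosed ((closedBall x r ∩ (hyperplane u : Set (Euc n))) +
      ((hyperplane u)ᗮ : Set (Euc n))) := by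
  have : ((closedBall x r ∩ (hyperplane u : Set (Euc n))) + ((hyperplane u)ᗮ : Set (Euc n)))
      = perpPart u ⁻¹' closedBall x r := by
    ext z; exact mem_cylinder_iff hu
  rw [this]
  exact isClosed_closedBall.preimage (perpPart u).continuous

end Geometry

/-! ### Essential inclusions between balls. -/

section Balls

variable {n : ℕ}

/-- The open ball minus a closed set is open, so it is empty once it is null; taking closures
recovers the closed ball. -/
theorem closedBall_subset_of_ae_le {c : Euc n} {r : ℝ} (hr : 0 < r) {S : Set (Euc n)}
    (hS : IsClosed S) (h : closedBall c r ≤ᵐ[volume] S) : closedBall c r ⊆ S := by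
  have h0 : volume (ball c r \ S) = 0 :=
    measure_mono_null (sdiff_subset_sdiff_left ball_subset_closedBall) (ae_le_set.1 h)
  have h1 : ball c r \ S = ∅ := (isOpen_ball.sdiff hS).measure_eq_zero_iff volume |>.1 h0
  rw [← closure_ball c hr.ne']
  exact closure_minimal (sdiff_eq_empty.1 h1) hS

theorem exists_norm_eq_one_smul [Nontrivial (Euc n)] (w : Euc n) :
    ∃ e : Euc n, ‖e‖ = 1 ∧ w = ‖w‖ • e := by
  by_cases h : w = 0
  · obtain ⟨e, he⟩ := exists_norm_eq (Euc n) zero_le_one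
    exact ⟨e, he, by simp [h]⟩
  · refine ⟨‖w‖⁻¹ • w, norm_smul_inv_norm h, ?_⟩
    rw [smul_smul, mul_inv_cancel₀ (norm_ne_zero_iff.2 h), one_smul]

/-- Test the inclusion on the point of the smaller ball farthest from `b`. Nontriviality supplies a
direction even when `a = b`. -/
theorem norm_sub_le_of_closedBall_subset [Nontrivial (Euc n)] {a b : Euc n} {r s : ℝ}
    (hr : 0 ≤ r) (h : closedBall a r ⊆ closedBall b s) : ‖a - b‖ ≤ s - r := by
  obtain ⟨e, he, hw⟩ := exists_norm_eq_one_smul (a - b)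
  have hz : a + r • e ∈ closedBall b s := h (by simp [norm_smul, he, abs_of_nonneg hr])
  rw [mem_closedBall, dist_eq_norm, show a + r • e - b = (‖a - b‖ + r) • e by
    rw [add_smul, ← hw]; abel, norm_smul, he, mul_one, Real.norm_eq_abs,
    abs_of_nonneg (by positivity)] at hz
  linarith

theorem norm_sub_le_of_closedBall_ae_le [Nontrivial (Euc n)] {a b : Euc n} {r s : ℝ}
    (hr : 0 < r) (h : closedBall a r ≤ᵐ[volume] closedBall b s) : ‖a - b‖ ≤ s - r :=
  norm_sub_le_of_closedBall_subset hr.le (closedBall_subset_of_ae_le hr isClosed_closedBall h)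

theorem eq_of_closedBall_ae_eq [Nontrivial (Euc n)] {a b : Euc n} {r : ℝ}
    (hr : 0 < r) (h : closedBall a r =ᵐ[volume] closedBall b r) : a = b := by
  have := norm_sub_le_of_closedBall_ae_le hr h.le
  rw [sub_self] at this
  exact sub_eq_zero.1 (norm_le_zero_iff.1 this)

theorem radius_eq_of_volume_eq [Nontrivial (Euc n)] {a b : Euc n} {r s : ℝ}
    (hr : 0 < r) (hs : 0 < s) (h : volume (closedBall a r) = volume (closedBall b s)) :
    r = s := by
  have hn : n ≠ 0 := by
    rintro rfl
    exact not_subsingleton (Euc 0) inferInstance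
  rw [Measure.addHaar_closedBall _ _ hr.le, Measure.addHaar_closedBall _ _ hs.le,
    ENNReal.mul_left_inj (measure_ball_pos volume _ one_pos).ne' measure_ball_lt_top.ne,
    ENNReal.ofReal_eq_ofReal_iff (by positivity) (by positivity), finrank_euclideanSpace_fin] at h
  exact (pow_left_inj₀ hr.le hs.le hn).1 h

theorem closedBall_mem_convexBodies (c : Euc n) {r : ℝ} (hr : 0 < r) :
    closedBall c r ∈ convexBodies n :=
  ⟨⟨⟨c, mem_closedBall_self hr.le⟩, isCompact_closedBall c r, convex_closedBall c r⟩,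
    ⟨c, ball_subset_interior_closedBall (mem_ball_self hr)⟩⟩

end Balls

/-! ### Existence and uniqueness of the shift function. -/

section ShiftFunction

variable {n : ℕ} {u : Euc n} {𝓔 : Set (Set (Euc n))} {D : 𝓔 → finiteMeasureSets n}

theorem exists_shift_of_ball [Nontrivial (Euc n)] (hu : ‖u‖ = 1)
    (hmeas : IsMeasurePreserving D) (hcyl : RespectsCylinders (hyperplane u) D)
    (hball : MapsBallsToBalls D) {x : Euc n} (hx : x ∈ hyperplane u) (t : ℝ) {r : ℝ}
    (hr : 0 < r) (hB : closedBall (x + t • u) r ∈ 𝓔) :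
    ∃ s : ℝ, (D ⟨_, hB⟩ : Set (Euc n)) =ᵐ[volume] closedBall (x + s • u) r := by
  obtain ⟨c, r', hr', hc⟩ := hball ⟨_, hB⟩ (x + t • u) r hr (ae_eq_refl _)
  have hrr : r' = r := radius_eq_of_volume_eq (a := c) (b := x + t • u) hr' hr (by
    rw [← measure_congr hc, hmeas ⟨_, hB⟩])
  subst hrr
  have hsub := hcyl ⟨_, hB⟩ x r' hr (LE.le.eventuallyLE (fun z hz => by
    rw [mem_cylinder_iff hu]
    rw [mem_closedBall, dist_eq_norm] at hz ⊢
    have : perpPart u z - x = perpPart u (z - (x + t • u)) := by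
      rw [map_sub, map_add, perpPart_smul_self hu, perpPart_eq_self hx, add_zero]
    rw [this]
    exact (norm_perpPart_le hu _).trans hz))
  have hsub' := closedBall_subset_of_ae_le hr (isClosed_cylinder hu x r') (hc.symm.le.trans hsub)
  -- If the projection of the centre were not `x`, moving from `c` by `r'` in the horizontal
  -- direction away from `x` would stay in the ball but leave the cylinder.
  have hpx : perpPart u c = x := by
    obtain ⟨e, he, hw⟩ := exists_norm_eq_one_smul (perpPart u c - x)
    by_contra hne
    have hpos : 0 < ‖perpPart u c - x‖ := norm_pos_iff.2 (sub_ne_zero.2 hne)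
    have heH : e ∈ hyperplane u := by
      have : e = ‖perpPart u c - x‖⁻¹ • (perpPart u c - x) := by
        conv_rhs => rw [hw, norm_smul, he]
        simp [smul_smul, inv_mul_cancel₀ hpos.ne']
      rw [this]
      exact Submodule.smul_mem _ _ (Submodule.sub_mem _ (perpPart_mem hu c) hx)
    have hz := hsub' (show c + r' • e ∈ closedBall c r' by simp [norm_smul, he, abs_of_pos hr])
    rw [mem_cylinder_iff hu, map_add, map_smul, perpPart_eq_self heH, mem_closedBall, dist_eq_norm,
      show perpPart u c + r' • e - x = (‖perpPart u c - x‖ + r') • e by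
        rw [add_smul, ← hw]; abel, norm_smul, he, mul_one, Real.norm_eq_abs,
      abs_of_nonneg (by positivity)] at hz
    linarith
  refine ⟨inner ℝ u c, ?_⟩
  have hcx : x + inner ℝ u c • u = c := by rw [← hpx, perpPart_add_smul]
  rw [hcx]
  exact hc

theorem existsUnique_shiftFunction (hn : 2 ≤ n) (hu : ‖u‖ = 1)
    (h𝓔 : convexBodies n ⊆ 𝓔) (hmono : IsMonotonic D)
    (hmeas : IsMeasurePreserving D) (hcyl : RespectsCylinders (hyperplane u) D)
    (hball : MapsBallsToBalls D) : ∃! φ : ℝ → ℝ, IsShiftFunction u D φ := by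
  have hu0 : u ≠ 0 := by rintro rfl; simp at hu
  have : Nontrivial (Euc n) := ⟨u, 0, hu0⟩
  have hB : ∀ (c : Euc n) {r : ℝ}, 0 < r → closedBall c r ∈ 𝓔 :=
    fun c r hr => h𝓔 (closedBall_mem_convexBodies c hr)
  -- The conditions on `x` and `r` sit inside the existential so that `choose` yields a total
  -- function of three variables; its value is irrelevant elsewhere.
  have hex : ∀ (x : Euc n) (t r : ℝ), ∃ s : ℝ, ∀ (_ : x ∈ hyperplane u) (hr : 0 < r),
      (D ⟨_, hB (x + t • u) hr⟩ : Set (Euc n)) =ᵐ[volume] closedBall (x + s • u) r := by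
    intro x t r
    by_cases h : x ∈ hyperplane u ∧ 0 < r
    · obtain ⟨s, hs⟩ := exists_shift_of_ball hu hmeas hcyl hball h.1 t h.2 (hB _ h.2)
      exact ⟨s, fun _ _ => hs⟩
    · exact ⟨0, fun h1 h2 => absurd ⟨h1, h2⟩ h⟩
  choose ψ hψ using hex
  have key : ∀ {x y : Euc n} {t s r R : ℝ}, x ∈ hyperplane u → y ∈ hyperplane u → 0 < r →
      0 < R → ‖x - y‖ ^ 2 + (t - s) ^ 2 ≤ (R - r) ^ 2 → r ≤ R →
      ‖x - y‖ ^ 2 + (ψ x t r - ψ y s R) ^ 2 ≤ (R - r) ^ 2 := by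
    intro x y t s r R hx hy hr hR h hrR
    have hnorm : ∀ a b : ℝ, ‖x + a • u - (y + b • u)‖ ^ 2 = ‖x - y‖ ^ 2 + (a - b) ^ 2 := by
      intro a b
      have hxy : x - y ∈ hyperplane u := Submodule.sub_mem _ hx hy
      rw [show x + a • u - (y + b • u) = (x - y) + (a - b) • u by module,
        norm_sq_eq_perpPart hu, inner_add_smul hu hxy, map_add, perpPart_smul_self hu, add_zero,
        perpPart_eq_self hxy]
    have h1 : ‖x + t • u - (y + s • u)‖ ≤ R - r := by
      refine pow_le_pow_iff_left₀ (norm_nonneg _) (by linarith) two_ne_zero |>.1 ?_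
      rw [hnorm]; exact h
    have h2 := hmono ⟨_, hB (x + t • u) hr⟩ ⟨_, hB (y + s • u) hR⟩
      (LE.le.eventuallyLE (closedBall_subset_closedBall' (by
        rw [dist_eq_norm]; linarith)))
    have h3 := norm_sub_le_of_closedBall_ae_le hr
      (((hψ x t r hx hr).symm.le.trans h2).trans (hψ y s R hy hR).le)
    rw [← hnorm]
    exact pow_le_pow_left₀ (norm_nonneg _) h3 2
  -- For internally tangent balls at equal height, the horizontal term in `key` already uses up `(R
  -- - r) ^ 2`, so the shifted heights must agree.
  have horiz : ∀ {x y : Euc n} {t r : ℝ}, x ∈ hyperplane u → y ∈ hyperplane u → 0 < r →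
      ψ x t r = ψ y t (r + ‖x - y‖) := by
    intro x y t r hx hy hr
    have := key (t := t) (s := t) (R := r + ‖x - y‖) hx hy hr (by positivity) (by simp)
      (by simp)
    have h0 : (ψ x t r - ψ y t (r + ‖x - y‖)) ^ 2 ≤ 0 := by
      rw [add_sub_cancel_left] at this
      linarith
    exact sub_eq_zero.1 (pow_eq_zero_iff two_ne_zero |>.1 (le_antisymm h0 (sq_nonneg _)))
  obtain ⟨v, hvH, hv0⟩ := exists_ne_zero_mem_hyperplane hn u
  have hrad : ∀ {x : Euc n} {t r R : ℝ}, x ∈ hyperplane u → 0 < r → r < R →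
      ψ x t r = ψ x t R := by
    intro x t r R hx hr hrR
    have hv : 0 < ‖v‖ := norm_pos_iff.2 hv0
    -- A step by `w` and a step back each enlarge the radius by `(R - r) / 2`, leading from radius
    -- `r` to radius `R` at the same centre.
    set w := ((R - r) / (2 * ‖v‖)) • v with hw
    have hwn : ‖w‖ = (R - r) / 2 := by
      rw [hw, norm_smul, Real.norm_eq_abs, abs_of_nonneg (div_nonneg (by linarith) (by positivity))]
      field_simp
    have hy : x + w ∈ hyperplane u := Submodule.add_mem _ hx (Submodule.smul_mem _ _ hvH)
    rw [horiz hx hy hr, horiz hy hx (by positivity)]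
    congr 1
    rw [show x - (x + w) = -w by abel, show x + w - x = w by abel, norm_neg, hwn]
    ring
  have hrad' : ∀ {x : Euc n} {t r R : ℝ}, x ∈ hyperplane u → 0 < r → 0 < R →
      ψ x t r = ψ x t R := by
    intro x t r R hx hr hR
    rcases lt_trichotomy r R with h | h | h
    · exact hrad hx hr h
    · rw [h]
    · exact (hrad hx hR h).symm
  have hall : ∀ {x : Euc n} {t r : ℝ}, x ∈ hyperplane u → 0 < r → ψ x t r = ψ 0 t 1 := by
    intro x t r hx hr
    rw [horiz hx (Submodule.zero_mem _) hr]
    exact hrad' (Submodule.zero_mem _) (by positivity) one_pos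
  refine ⟨fun t => ψ 0 t 1, ⟨?_, ?_⟩, ?_⟩
  · refine LipschitzWith.of_dist_le_mul fun s t => ?_
    rw [NNReal.coe_one, one_mul, Real.dist_eq, Real.dist_eq]
    have h0 : (0 : Euc n) ∈ hyperplane u := Submodule.zero_mem _
    have := key (t := s) (s := t) (r := 1) (R := 1 + |s - t|) h0 h0 one_pos (by positivity)
      (by simp) (by simp)
    rw [hall h0 (show (0 : ℝ) < 1 + |s - t| by positivity)] at this
    refine sq_le_sq₀ (abs_nonneg _) (abs_nonneg _) |>.1 ?_
    simpa using this
  · rintro ⟨K, hK⟩ x t r hx hr rfl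
    have := hψ x t r hx hr
    rwa [hall hx hr] at this
  · intro φ hφ
    funext t
    have h0 : (0 : Euc n) ∈ hyperplane u := Submodule.zero_mem _
    have h1 := hφ.2 ⟨_, hB (0 + t • u) one_pos⟩ 0 t 1 h0 one_pos rfl
    have h2 := eq_of_closedBall_ae_eq one_pos (h1.symm.trans (hψ 0 t 1 h0 one_pos))
    exact smul_left_injective ℝ hu0 (add_left_cancel h2)

end ShiftFunction

/-! ### Volume and position of solid cylinders. -/

section FiniteCylinder

variable {n : ℕ} {u : Euc n}

/-- The solid cylinder with axis `u`, centre `c`, radius `δ` and half-height `h`. -/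
def solidCylinder (u c : Euc n) (δ h : ℝ) : Set (Euc n) :=
  {z | ‖perpPart u (z - c)‖ ≤ δ ∧ |inner ℝ u (z - c)| ≤ h}

theorem isClosed_solidCylinder (u c : Euc n) (δ h : ℝ) : IsClosed (solidCylinder u c δ h) := by
  change IsClosed ({z | ‖perpPart u (z - c)‖ ≤ δ} ∩ {z | |inner ℝ u (z - c)| ≤ h})
  refine IsClosed.inter (isClosed_le ?_ continuous_const) (isClosed_le ?_ continuous_const)
  · exact ((perpPart u).continuous.comp (continuous_id.sub continuous_const)).norm
  · exact (continuous_const.inner (continuous_id.sub continuous_const)).abs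

theorem convex_solidCylinder (u c : Euc n) (δ h : ℝ) : Convex ℝ (solidCylinder u c δ h) := by
  have h1 : solidCylinder u c δ h = (fun z => z - c) ⁻¹'
      (perpPart u ⁻¹' closedBall 0 δ ∩ innerSL ℝ u ⁻¹' closedBall 0 h) := by
    ext z; simp [solidCylinder]
  rw [h1]
  simp only [sub_eq_add_neg]
  refine Convex.translate_preimage_left ?_ _
  exact ((convex_closedBall _ _).linear_preimage (perpPart u : Euc n →ₗ[ℝ] Euc n)).inter
    ((convex_closedBall _ _).linear_preimage (innerSL ℝ u : Euc n →ₗ[ℝ] ℝ))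

theorem solidCylinder_subset_closedBall (hu : ‖u‖ = 1) (c : Euc n) {δ h R : ℝ}
    (hR : 0 ≤ R) (h1 : δ ^ 2 + h ^ 2 ≤ R ^ 2) :
    solidCylinder u c δ h ⊆ closedBall c R := by
  rintro z ⟨hz1, hz2⟩
  rw [mem_closedBall, dist_eq_norm]
  refine pow_le_pow_iff_left₀ (norm_nonneg _) hR two_ne_zero |>.1 ?_
  rw [norm_sq_eq_perpPart hu, ← sq_abs (inner ℝ u (z - c))]
  have := pow_le_pow_left₀ (norm_nonneg _) hz1 2
  have := pow_le_pow_left₀ (abs_nonneg _) hz2 2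
  linarith

theorem closedBall_subset_solidCylinder (hu : ‖u‖ = 1) {c y : Euc n} {δ ρ h : ℝ}
    (hδ : ‖perpPart u (y - c)‖ + ρ ≤ δ) (hh : |inner ℝ u (y - c)| + ρ ≤ h) :
    closedBall y ρ ⊆ solidCylinder u c δ h := by
  intro z hz
  rw [mem_closedBall, dist_eq_norm] at hz
  rw [solidCylinder, mem_ofPred_eq, show z - c = (y - c) + (z - y) by abel, map_add,
    inner_add_right]
  exact ⟨(norm_add_le _ _).trans (by linarith [norm_perpPart_le hu (z - y)]),
    (abs_add_le _ _).trans (by linarith [abs_inner_le hu (z - y)])⟩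

theorem solidCylinder_mem_convexBodies (hu : ‖u‖ = 1) (c : Euc n) {δ h : ℝ} (hδ : 0 < δ)
    (hh : 0 < h) : solidCylinder u c δ h ∈ convexBodies n := by
  have hsub : closedBall c (min δ h) ⊆ solidCylinder u c δ h :=
    closedBall_subset_solidCylinder hu (by simp) (by simp)
  have hpos : 0 < min δ h := lt_min hδ hh
  refine ⟨⟨⟨c, hsub (mem_closedBall_self hpos.le)⟩, ?_, convex_solidCylinder u c δ h⟩, c,
    interior_mono hsub (ball_subset_interior_closedBall (mem_ball_self hpos))⟩
  exact (isCompact_closedBall c (δ + h)).of_isClosed_subset (isClosed_solidCylinder u c δ h)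
    (solidCylinder_subset_closedBall hu c (by positivity) (by nlinarith))

theorem volume_solidCylinder (hu : ‖u‖ = 1) (hn : n ≠ 0) (c : Euc n) {δ h : ℝ} (hδ : 0 < δ)
    (hh : 0 < h) : volume (solidCylinder u c δ h) =
      ENNReal.ofReal (δ ^ (n - 1) * h) * volume (solidCylinder u 0 1 1) := by
  -- `T` stretches the axis by `h / δ` and fixes `H`, so `δ • T` scales by `h` along `u` and by `δ`
  -- across it.
  set T : Euc n →ₗ[ℝ] Euc n := LinearMap.transvection (innerSL ℝ u : Euc n →ₗ[ℝ] ℝ)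
    (((h - δ) / δ) • u) with hT
  have hTapp : ∀ w, (δ • T) w = δ • perpPart u w + (h * inner ℝ u w) • u := by
    intro w
    simp only [hT, LinearMap.smul_apply, LinearMap.transvection.apply, perpPart_apply,
      ContinuousLinearMap.coe_coe, innerSL_apply_apply]
    match_scalars <;> field_simp
    ring
  have hperp : ∀ w, perpPart u ((δ • T) w) = δ • perpPart u w := by
    intro w
    rw [hTapp, map_add, map_smul, perpPart_smul_self hu, perpPart_eq_self (perpPart_mem hu w),
      add_zero]
  have hinner : ∀ w, inner ℝ u ((δ • T) w) = h * inner ℝ u w := by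
    intro w
    rw [hTapp, ← map_smul]
    rw [inner_add_smul hu (perpPart_mem hu _)]
  have hdet : LinearMap.det (δ • T) = δ ^ (n - 1) * h := by
    rw [LinearMap.det_smul, hT, LinearMap.transvection.det, finrank_euclideanSpace_fin]
    simp only [map_smul, ContinuousLinearMap.coe_coe, innerSL_apply_apply,
      inner_self_of_norm_eq_one hu, smul_eq_mul, mul_one]
    obtain ⟨k, rfl⟩ := Nat.exists_eq_succ_of_ne_zero hn
    simp only [Nat.succ_eq_add_one, Nat.add_sub_cancel, pow_succ]
    field_simp
    ring
  have himage : solidCylinder u c δ h = (fun z => c + z) '' ((δ • T) '' solidCylinder u 0 1 1) := by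
    ext z
    constructor
    · rintro ⟨h1, h2⟩
      set w := δ⁻¹ • perpPart u (z - c) + (h⁻¹ * inner ℝ u (z - c)) • u with hw
      have hw1 : perpPart u w = δ⁻¹ • perpPart u (z - c) := by
        rw [hw, map_add, perpPart_smul_self hu, map_smul, perpPart_eq_self (perpPart_mem hu _),
          add_zero]
      have hw2 : inner ℝ u w = h⁻¹ * inner ℝ u (z - c) := by
        rw [hw, ← map_smul, inner_add_smul hu (perpPart_mem hu _)]
      refine ⟨z - c, ⟨w, ?_, ?_⟩, by simp⟩
      · rw [solidCylinder, mem_ofPred_eq, sub_zero, hw1, hw2, norm_smul, abs_mul, Real.norm_eq_abs,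
          abs_inv, abs_inv, abs_of_pos hδ, abs_of_pos hh, inv_mul_le_iff₀ hδ, inv_mul_le_iff₀ hh,
          mul_one, mul_one]
        exact ⟨h1, h2⟩
      · rw [hTapp, hw1, hw2, smul_smul, mul_inv_cancel₀ hδ.ne', one_smul,
          mul_inv_cancel_left₀ hh.ne', perpPart_add_smul]
    · rintro ⟨_, ⟨w, ⟨h1, h2⟩, rfl⟩, rfl⟩
      rw [sub_zero] at h1 h2
      simp only [solidCylinder, mem_ofPred_eq, add_sub_cancel_left]
      rw [hperp, hinner, norm_smul, abs_mul, Real.norm_eq_abs, abs_of_pos hδ, abs_of_pos hh]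
      exact ⟨mul_le_of_le_one_right hδ.le h1, mul_le_of_le_one_right hh.le h2⟩
  rw [himage, image_add_left, measure_preimage_add, Measure.addHaar_image_linearMap, hdet,
    abs_of_pos (by positivity)]

theorem exists_solidCylinder_subset {U : Set (Euc n)} (hU : IsOpen U)
    {x : Euc n} {m h : ℝ}
    (hseg : ∀ τ, |τ - m| ≤ h → x + τ • u ∈ U) :
    ∃ δ₀ > 0, ∀ δ ≤ δ₀, solidCylinder u (x + m • u) δ h ⊆ U := by
  have hc : IsCompact ((fun τ : ℝ => x + τ • u) '' closedBall m h) :=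
    (isCompact_closedBall m h).image (by fun_prop)
  obtain ⟨δ₀, hδ₀, hsub⟩ := hc.exists_cthickening_subset_open hU (by
    rintro _ ⟨τ, hτ, rfl⟩
    exact hseg τ (by simpa [Real.dist_eq] using hτ))
  refine ⟨δ₀, hδ₀, fun δ hδ z hz => hsub ?_⟩
  refine mem_cthickening_of_dist_le z (x + (m + inner ℝ u (z - (x + m • u))) • u) δ₀ _
    ⟨_, ?_, rfl⟩ ?_
  · simpa [Real.dist_eq] using hz.2
  · rw [dist_eq_norm]
    refine le_trans (le_of_eq ?_) (hz.1.trans hδ)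
    rw [perpPart_apply]
    congr 1
    module

end FiniteCylinder

/-! ### Density points of the image, and recovery of `D K`. -/

section Density

variable {n : ℕ} {u : Euc n} {𝓔 : Set (Set (Euc n))} {D : 𝓔 → finiteMeasureSets n} {φ : ℝ → ℝ}

/-- A thin solid cylinder is mapped into the cylinder of the same radius whose centre is moved by
the shift function and whose half-height is only slightly larger. -/
theorem image_solidCylinder_ae_le (hu : ‖u‖ = 1) (h𝓔 : convexBodies n ⊆ 𝓔) (hmono : IsMonotonic D)
    (hcyl : RespectsCylinders (hyperplane u) D) (hφ : IsShiftFunction u D φ) {x : Euc n}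
    (hx : x ∈ hyperplane u) (m : ℝ) {δ h R : ℝ} (hδ : 0 < δ) (hR : 0 < R)
    (hL : solidCylinder u (x + m • u) δ h ∈ 𝓔) (h1 : δ ^ 2 + h ^ 2 ≤ R ^ 2) :
    (D ⟨_, hL⟩ : Set (Euc n)) ≤ᵐ[volume] solidCylinder u (x + φ m • u) δ R := by
  have hperp : ∀ (a : ℝ) (z : Euc n), perpPart u (z - (x + a • u)) = perpPart u z - x := by
    intro a z
    rw [map_sub, map_add, perpPart_smul_self hu, perpPart_eq_self hx, add_zero]
  have hB : closedBall (x + m • u) R ∈ 𝓔 := h𝓔 (closedBall_mem_convexBodies _ hR)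
  have hD1 := hcyl ⟨_, hL⟩ x δ hδ (LE.le.eventuallyLE (fun z hz => by
    rw [mem_cylinder_iff hu, mem_closedBall, dist_eq_norm, ← hperp m]
    exact hz.1))
  have hD2 := (hmono ⟨_, hL⟩ ⟨_, hB⟩ (LE.le.eventuallyLE
    (solidCylinder_subset_closedBall hu _ hR.le h1))).trans
    (hφ.2 ⟨_, hB⟩ x m R hx hR rfl).le
  filter_upwards [hD1, hD2] with z hz1 hz2 hz
  have h3 : z ∈ (closedBall x δ ∩ (hyperplane u : Set (Euc n))) +
      ((hyperplane u)ᗮ : Set (Euc n)) := hz1 hz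
  have h4 : z ∈ closedBall (x + φ m • u) R := hz2 hz
  rw [mem_cylinder_iff hu, mem_closedBall, dist_eq_norm, ← hperp (φ m)] at h3
  rw [mem_closedBall, dist_eq_norm] at h4
  exact ⟨h3, (abs_inner_le hu _).trans h4⟩

/-- If a segment parallel to `u` lies in the interior of `K`, then its translate along `u` that
moves the midpoint according to the shift function consists of density points of `D K`. -/
theorem tendsto_volume_closedBall_sdiff (hn : n ≠ 0) (hu : ‖u‖ = 1) (h𝓔 : convexBodies n ⊆ 𝓔)
    (hmono : IsMonotonic D) (hmeas : IsMeasurePreserving D)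
    (hcyl : RespectsCylinders (hyperplane u) D) (hφ : IsShiftFunction u D φ) (K : 𝓔) {x : Euc n}
    (hx : x ∈ hyperplane u) {m h s : ℝ} (hs : |s| < h)
    (hseg : ∀ τ, |τ - m| ≤ h → x + τ • u ∈ interior (K : Set (Euc n))) :
    Tendsto (fun δ => volume (closedBall (x + (φ m + s) • u) δ \ (D K : Set (Euc n))) /
      volume (closedBall (x + (φ m + s) • u) δ)) (𝓝[>] 0) (𝓝 0) := by
  have hh : 0 < h := (abs_nonneg s).trans_lt hs
  set v := volume (solidCylinder u (0 : Euc n) 1 1) with hv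
  set β := volume (ball (0 : Euc n) 1) with hβ
  have hβ0 : β ≠ 0 := (measure_ball_pos volume _ one_pos).ne'
  have hβt : β ≠ ⊤ := measure_ball_lt_top.ne
  have hvt : v ≠ ⊤ :=
    (solidCylinder_mem_convexBodies hu 0 one_pos one_pos).1.2.1.measure_lt_top.ne
  obtain ⟨δ₀, hδ₀, hsub⟩ := exists_solidCylinder_subset isOpen_interior hseg
  have hbound : ∀ᶠ δ in 𝓝[>] (0 : ℝ),
      volume (closedBall (x + (φ m + s) • u) δ \ (D K : Set (Euc n))) /
        volume (closedBall (x + (φ m + s) • u) δ) ≤ ENNReal.ofReal (δ / (2 * h)) * (v / β) := by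
    -- The bound `δ₀` keeps the thin cylinder inside `K`; `h - |s|` keeps the test ball inside the
    -- shifted cylinder `L'`.
    have hev : ∀ᶠ δ in 𝓝[>] (0 : ℝ), δ < min δ₀ (h - |s|) :=
      mem_nhdsWithin_of_mem_nhds (Iio_mem_nhds (lt_min hδ₀ (by linarith)))
    filter_upwards [hev, self_mem_nhdsWithin] with δ hδlt hδ
    replace hδ : 0 < δ := hδ
    have hδ1 := hδlt.trans_le (min_le_left _ _)
    have hδ2 := hδlt.trans_le (min_le_right _ _)
    -- An explicit upper bound for `√(h² + δ²)` whose excess over `h` is quadratic in `δ`.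
    set R := h + δ ^ 2 / (2 * h) with hRdef
    have hR : 0 < R := by positivity
    have hRsq : δ ^ 2 + h ^ 2 ≤ R ^ 2 := by
      have : R ^ 2 = δ ^ 2 + h ^ 2 + (δ ^ 2 / (2 * h)) ^ 2 := by
        rw [hRdef]; field_simp; ring
      rw [this]
      nlinarith [sq_nonneg (δ ^ 2 / (2 * h))]
    have hL := h𝓔 (solidCylinder_mem_convexBodies hu (x + m • u) hδ hh)
    set L' := solidCylinder u (x + φ m • u) δ R with hL'
    have hDL := image_solidCylinder_ae_le hu h𝓔 hmono hcyl hφ hx m hδ hR hL hRsq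
    have hDK := hmono ⟨_, hL⟩ K (LE.le.eventuallyLE ((hsub δ hδ1.le).trans interior_subset))
    have hball : closedBall (x + (φ m + s) • u) δ ⊆ L' := by
      refine closedBall_subset_solidCylinder hu ?_ ?_ <;>
        rw [show x + (φ m + s) • u - (x + φ m • u) = s • u by module]
      · rw [perpPart_smul_self hu]; simp
      · rw [inner_smul_right, inner_self_of_norm_eq_one hu, mul_one]
        have : 0 ≤ δ ^ 2 / (2 * h) := by positivity
        linarith
    -- The image lies essentially in `L'` and has the volume of the original cylinder, so the defect
    -- comes only from the extra height `R - h`.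
    have hX : volume (L' \ (D ⟨_, hL⟩ : Set (Euc n))) =
        ENNReal.ofReal (δ ^ (n - 1) * (δ ^ 2 / (2 * h))) * v := by
      have h1 := measure_inter_add_sdiff₀ (μ := volume) L' (D ⟨_, hL⟩).2.1
      have h2 : volume (L' ∩ (D ⟨_, hL⟩ : Set (Euc n))) =
          ENNReal.ofReal (δ ^ (n - 1) * h) * v := by
        rw [← volume_solidCylinder hu hn (x + m • u) hδ hh, ← hmeas ⟨_, hL⟩]
        refine le_antisymm (measure_mono inter_subset_right) (measure_mono_ae ?_)
        filter_upwards [hDL] with z hz h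
        exact ⟨hz h, h⟩
      rw [h2, hL', volume_solidCylinder hu hn _ hδ hR, hRdef, mul_add,
        ENNReal.ofReal_add (by positivity) (by positivity), add_mul] at h1
      exact (ENNReal.add_right_inj (ENNReal.mul_ne_top ENNReal.ofReal_ne_top hvt)).1 h1
    have hY : volume (closedBall (x + (φ m + s) • u) δ \ (D K : Set (Euc n))) ≤
        volume (L' \ (D ⟨_, hL⟩ : Set (Euc n))) := by
      refine measure_mono_ae ?_
      filter_upwards [hDK] with z hz hz'
      exact ⟨hball hz'.1, fun h => hz'.2 (hz h)⟩
    refine ENNReal.div_le_of_le_mul (hY.trans (le_of_eq ?_))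
    rw [hX, Measure.addHaar_closedBall _ _ hδ.le, finrank_euclideanSpace_fin, ← hβ]
    have hpow : δ ^ (n - 1) * (δ ^ 2 / (2 * h)) = δ / (2 * h) * δ ^ n := by
      obtain ⟨k, rfl⟩ := Nat.exists_eq_succ_of_ne_zero hn
      simp only [Nat.succ_eq_add_one, Nat.add_sub_cancel, pow_succ]
      ring
    rw [hpow, ENNReal.ofReal_mul (by positivity)]
    calc ENNReal.ofReal (δ / (2 * h)) * ENNReal.ofReal (δ ^ n) * v
        = ENNReal.ofReal (δ / (2 * h)) * ENNReal.ofReal (δ ^ n) * (v / β * β) := by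
          rw [ENNReal.div_mul_cancel hβ0 hβt]
      _ = _ := by ring
  have hlim : Tendsto (fun δ => ENNReal.ofReal (δ / (2 * h)) * (v / β)) (𝓝[>] 0) (𝓝 0) := by
    have h1 : Tendsto (fun δ : ℝ => ENNReal.ofReal (δ / (2 * h))) (𝓝[>] 0) (𝓝 0) := by
      have : Tendsto (fun δ : ℝ => δ / (2 * h)) (𝓝 0) (𝓝 0) := by
        simpa using (continuous_id.div_const (2 * h)).tendsto (0 : ℝ)
      simpa using (ENNReal.tendsto_ofReal this).mono_left nhdsWithin_le_nhds
    simpa using ENNReal.Tendsto.mul_const h1 (Or.inr (ENNReal.div_ne_top hvt hβ0))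
  exact tendsto_of_tendsto_of_tendsto_of_le_of_le' tendsto_const_nhds hlim
    (Eventually.of_forall fun _ => zero_le) hbound

/-- Almost every point of `G \ A` is a point of density one for `G \ A`, whereas the hypothesis
makes that density zero. -/
theorem ae_le_of_tendsto_volume_sdiff {G A : Set (Euc n)} (hG : NullMeasurableSet G volume)
    (hA : NullMeasurableSet A volume)
    (h : ∀ y ∈ G, Tendsto (fun δ => volume (closedBall y δ \ A) / volume (closedBall y δ))
      (𝓝[>] 0) (𝓝 0)) : G ≤ᵐ[volume] A := by
  rw [ae_le_set, ← Measure.restrict_eq_zero, ← ae_eq_bot, ← eventually_false_iff_eq_bot]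
  filter_upwards [Besicovitch.ae_tendsto_measure_inter_div volume (G \ A),
    ae_restrict_mem₀ (hG.diff hA)] with y hy hyN
  have h0 : Tendsto (fun δ => volume ((G \ A) ∩ closedBall y δ) / volume (closedBall y δ))
      (𝓝[>] 0) (𝓝 0) :=
    tendsto_of_tendsto_of_tendsto_of_le_of_le tendsto_const_nhds (h y hyN.1)
      (fun _ => zero_le) (fun δ => ENNReal.div_le_div_right
        (measure_mono (show (G \ A) ∩ closedBall y δ ⊆ closedBall y δ \ A from
          fun z hz => ⟨hz.2, hz.1.2⟩)) _)
  exact zero_ne_one (tendsto_nhds_unique h0 hy)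

/-- `D K` is determined up to null sets by the shift function. -/
theorem image_ae_eq_of_segments (hn : n ≠ 0) (hu : ‖u‖ = 1) (h𝓔 : convexBodies n ⊆ 𝓔)
    (hmono : IsMonotonic D) (hmeas : IsMeasurePreserving D)
    (hcyl : RespectsCylinders (hyperplane u) D) (hφ : IsShiftFunction u D φ) (K : 𝓔)
    {G : Set (Euc n)} (hG : NullMeasurableSet G volume)
    (hKG : volume (K : Set (Euc n)) ≤ volume G)
    (hseg : ∀ y ∈ G, ∃ x ∈ hyperplane u, ∃ m h s : ℝ, |s| < h ∧ y = x + (φ m + s) • u ∧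
      ∀ τ, |τ - m| ≤ h → x + τ • u ∈ interior (K : Set (Euc n))) :
    (D K : Set (Euc n)) =ᵐ[volume] G := by
  -- Density gives only `G ⊆ D K`; the reverse inclusion follows from finite measure and `volume (D
  -- K) = volume K ≤ volume G`.
  refine (ae_eq_of_ae_subset_of_measure_ge (ae_le_of_tendsto_volume_sdiff hG (D K).2.1 ?_)
    ((hmeas K).trans_le hKG) hG (D K).2.2.ne).symm
  intro y hy
  obtain ⟨x, hx, m, h, s, hs, rfl, hK⟩ := hseg y hy
  exact tendsto_volume_closedBall_sdiff hn hu h𝓔 hmono hmeas hcyl hφ K hx hs hK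

end Density

/-! ### Reflection and polarization of sets: null sets, volume, balls. -/

section SetMaps

variable {n : ℕ} {u : Euc n}

theorem reflectSet_eq_preimage (H : Submodule ℝ (Euc n)) (A : Set (Euc n)) :
    reflectSet H A = H.reflection ⁻¹' A := by
  rw [reflectSet, LinearIsometryEquiv.image_eq_preimage_symm, Submodule.reflection_symm]

theorem measurePreserving_reflection (H : Submodule ℝ (Euc n)) :
    MeasurePreserving H.reflection (volume : Measure (Euc n)) volume :=
  H.reflection.measurePreserving

theorem volume_reflection_preimage (H : Submodule ℝ (Euc n)) {A : Set (Euc n)}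
    (hA : MeasurableSet A) : volume (H.reflection ⁻¹' A) = volume A :=
  (measurePreserving_reflection H).measure_preimage hA.nullMeasurableSet

theorem reflectSet_congr_ae (H : Submodule ℝ (Euc n)) {A B : Set (Euc n)}
    (h : A =ᵐ[volume] B) : reflectSet H A =ᵐ[volume] reflectSet H B := by
  rw [reflectSet_eq_preimage, reflectSet_eq_preimage]
  exact (measurePreserving_reflection H).quasiMeasurePreserving.preimage_ae_eq h

theorem mem_polarizeSet_iff {A : Set (Euc n)} {z : Euc n} :
    z ∈ polarizeSet u A ↔
      (0 ≤ inner ℝ u z ∧ (z ∈ A ∨ (hyperplane u).reflection z ∈ A)) ∨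
      (inner ℝ u z < 0 ∧ z ∈ A ∧ (hyperplane u).reflection z ∈ A) := by
  classical
  simp only [polarizeSet, polarize, mem_ofPred_eq, indicator_apply]
  by_cases h0 : 0 ≤ inner ℝ u z <;> by_cases h1 : z ∈ A <;>
    by_cases h2 : (hyperplane u).reflection z ∈ A <;> simp [h0, h1, h2]
  all_goals linarith

theorem polarizeSet_congr_ae {A B : Set (Euc n)} (h : A =ᵐ[volume] B) :
    polarizeSet u A =ᵐ[volume] polarizeSet u B := by
  have h' := (measurePreserving_reflection (hyperplane u)).quasiMeasurePreserving.preimage_ae_eq h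
  filter_upwards [h.mem_iff, h'.mem_iff] with z hz hz'
  refine propext ?_
  change z ∈ polarizeSet u A ↔ z ∈ polarizeSet u B
  simp only [mem_preimage] at hz'
  rw [mem_polarizeSet_iff, mem_polarizeSet_iff, hz, hz']

theorem measurableSet_polarizeSet {A : Set (Euc n)} (hA : MeasurableSet A) :
    MeasurableSet (polarizeSet u A) := by
  have hA' : MeasurableSet ((hyperplane u).reflection ⁻¹' A) :=
    (hyperplane u).reflection.continuous.measurable hA
  have hp : MeasurableSet {z : Euc n | 0 ≤ inner ℝ u z} :=
    measurableSet_le measurable_const (by fun_prop)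
  have hm : MeasurableSet {z : Euc n | inner ℝ u z < 0} :=
    measurableSet_lt (by fun_prop) measurable_const
  have : polarizeSet u A = {z | 0 ≤ inner ℝ u z} ∩ (A ∪ (hyperplane u).reflection ⁻¹' A) ∪
      {z | inner ℝ u z < 0} ∩ (A ∩ (hyperplane u).reflection ⁻¹' A) := by
    ext z; exact mem_polarizeSet_iff
  rw [this]
  exact (hp.inter (hA.union hA')).union (hm.inter (hA.inter hA'))

/-- Polarization does not decrease volume. -/
theorem volume_le_volume_polarizeSet (hu : ‖u‖ = 1) {A : Set (Euc n)} (hA : MeasurableSet A) :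
    volume A ≤ volume (polarizeSet u A) := by
  set T := (hyperplane u).reflection with hT
  have hTT : ∀ z, T (T z) = z := fun z => Submodule.reflection_reflection _ z
  have hA' : MeasurableSet (T ⁻¹' A) := T.continuous.measurable hA
  have hp : MeasurableSet {z : Euc n | 0 ≤ inner ℝ u z} :=
    measurableSet_le measurable_const (by fun_prop)
  have hm : MeasurableSet {z : Euc n | inner ℝ u z < 0} :=
    measurableSet_lt (by fun_prop) measurable_const
  set P := A ∩ {z | 0 ≤ inner ℝ u z}
  set Q := A ∩ T ⁻¹' A ∩ {z | inner ℝ u z < 0}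
  -- This is the only part of `A` that polarization moves: it is replaced by its mirror image, which
  -- is disjoint from `A`, while `P` and `Q` stay.
  set S := (A \ T ⁻¹' A) ∩ {z | inner ℝ u z < 0}
  have hP : MeasurableSet P := hA.inter hp
  have hQ : MeasurableSet Q := (hA.inter hA').inter hm
  have hS : MeasurableSet S := (hA.diff hA').inter hm
  have hS' : MeasurableSet (T ⁻¹' S) := T.continuous.measurable hS
  have hS'pos : ∀ z ∈ T ⁻¹' S, 0 < inner ℝ u z := by
    intro z hz
    have h : inner ℝ u (T z) < 0 := hz.2
    rw [inner_reflection hu] at h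
    linarith
  have hcover : A ⊆ (P ∪ Q) ∪ S := by
    intro z hz
    by_cases h0 : 0 ≤ inner ℝ u z
    · exact Or.inl (Or.inl ⟨hz, h0⟩)
    · by_cases h1 : T z ∈ A
      · exact Or.inl (Or.inr ⟨⟨hz, h1⟩, not_le.1 h0⟩)
      · exact Or.inr ⟨⟨hz, h1⟩, not_le.1 h0⟩
  have hsub : (P ∪ Q) ∪ T ⁻¹' S ⊆ polarizeSet u A := by
    rintro z ((hz | hz) | hz) <;> rw [mem_polarizeSet_iff]
    · exact Or.inl ⟨hz.2, Or.inl hz.1⟩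
    · exact Or.inr ⟨hz.2, hz.1⟩
    · exact Or.inl ⟨(hS'pos z hz).le, Or.inr hz.1.1⟩
  have hdisj : Disjoint (P ∪ Q) (T ⁻¹' S) := by
    rw [Set.disjoint_left]
    rintro z (hz | hz) hz'
    · have h1 : T (T z) ∉ A := hz'.1.2
      rw [hTT] at h1
      exact h1 hz.1
    · exact lt_asymm hz.2 (hS'pos z hz')
  calc volume A ≤ volume ((P ∪ Q) ∪ S) := measure_mono hcover
    _ ≤ volume (P ∪ Q) + volume S := measure_union_le _ _
    _ = volume (P ∪ Q) + volume (T ⁻¹' S) := by rw [volume_reflection_preimage _ hS]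
    _ = volume ((P ∪ Q) ∪ T ⁻¹' S) := (measure_union hdisj hS').symm
    _ ≤ _ := measure_mono hsub

theorem reflectSet_closedBall (hu : ‖u‖ = 1) (t r : ℝ) :
    reflectSet (hyperplane u) (closedBall (t • u) r) = closedBall ((-t) • u) r := by
  rw [reflectSet, LinearIsometryEquiv.image_closedBall, reflection_hyperplane_apply hu,
    inner_smul_right, inner_self_of_norm_eq_one hu]
  congr 1
  module

theorem dist_smul_le_dist_neg_smul {z : Euc n} {t : ℝ} (h : 0 ≤ t * inner ℝ u z) :
    dist z (t • u) ≤ dist z ((-t) • u) := by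
  rw [dist_eq_norm, dist_eq_norm]
  refine pow_le_pow_iff_left₀ (norm_nonneg _) (norm_nonneg _) two_ne_zero |>.1 ?_
  rw [norm_sub_sq_real, norm_sub_sq_real, inner_smul_right, inner_smul_right, norm_smul, norm_smul,
    norm_neg, real_inner_comm]
  linarith

/-- The balls at `±t • u` are mirror images. Where `0 ≤ inner ℝ u z`, the centre `|t| • u` is at
least as near as its mirror image, so the union is its ball; on the other side the comparison
reverses and the intersection is its ball. -/
theorem polarizeSet_closedBall (hu : ‖u‖ = 1) (t r : ℝ) :
    polarizeSet u (closedBall (t • u) r) = closedBall (|t| • u) r := by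
  ext z
  have hrefl : (hyperplane u).reflection z ∈ closedBall (t • u) r ↔
      z ∈ closedBall ((-t) • u) r := by
    rw [← reflectSet_closedBall hu, reflectSet_eq_preimage, mem_preimage]
  have habs : |t| = t ∨ |t| = -t := abs_choice t
  have hor : (z ∈ closedBall (t • u) r ∨ z ∈ closedBall ((-t) • u) r) ↔
      (z ∈ closedBall (|t| • u) r ∨ z ∈ closedBall ((-|t|) • u) r) := by
    rcases habs with h | h <;> rw [h]
    rw [neg_neg, or_comm]
  have hand : (z ∈ closedBall (t • u) r ∧ z ∈ closedBall ((-t) • u) r) ↔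
      (z ∈ closedBall (|t| • u) r ∧ z ∈ closedBall ((-|t|) • u) r) := by
    rcases habs with h | h <;> rw [h]
    rw [neg_neg, and_comm]
  rw [mem_polarizeSet_iff, hrefl, hor, hand]
  simp only [mem_closedBall]
  constructor
  · rintro (⟨h0, h | h⟩ | ⟨-, h, -⟩)
    · exact h
    · exact (dist_smul_le_dist_neg_smul (mul_nonneg (abs_nonneg t) h0)).trans h
    · exact h
  · intro h
    rcases le_or_gt 0 (inner ℝ u z) with h0 | h0
    · exact Or.inl ⟨h0, Or.inl h⟩
    · have := dist_smul_le_dist_neg_smul (t := -|t|)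
        (mul_nonneg_of_nonpos_of_nonpos (neg_nonpos.2 (abs_nonneg t)) h0.le)
      rw [neg_neg] at this
      exact Or.inr ⟨h0, h, this.trans h⟩

end SetMaps

/-! ### Points reached by shifting segments parallel to `u`. -/

section Segments

variable {n : ℕ} {u : Euc n} {U : Set (Euc n)}

theorem exists_segment_subset (hU : IsOpen U) {x : Euc n} {t : ℝ} (h : x + t • u ∈ U) :
    ∃ ε > 0, ∀ τ, |τ - t| ≤ ε → x + τ • u ∈ U := by
  have hV : IsOpen ((fun τ : ℝ => x + τ • u) ⁻¹' U) := hU.preimage (by fun_prop)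
  obtain ⟨ε, hε, hsub⟩ := nhds_basis_closedBall.mem_iff.1 (hV.mem_nhds h)
  exact ⟨ε, hε, fun τ hτ => hsub (by simpa [Real.dist_eq] using hτ)⟩

/-- Openness extends the segment slightly beyond both endpoints and convexity fills it in; the slack
gives the strict inequality needed in `IsReached`. -/
theorem exists_symm_segment_subset (hU : IsOpen U) (hc : Convex ℝ U) {x : Euc n} {t : ℝ}
    (h1 : x + t • u ∈ U) (h2 : x + (-t) • u ∈ U) :
    ∃ h, |t| < h ∧ ∀ τ, |τ - 0| ≤ h → x + τ • u ∈ U := by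
  have hord : OrdConnected ((fun τ : ℝ => x + τ • u) ⁻¹' U) := by
    refine Convex.ordConnected ?_
    intro a ha b hb p q hp hq hpq
    have := hc ha hb hp hq hpq
    change x + (p • a + q • b) • u ∈ U
    convert this using 1
    have hx : x = (p + q) • x := by rw [hpq, one_smul]
    conv_lhs => rw [hx]
    simp only [smul_eq_mul]
    module
  have h3 : x + |t| • u ∈ U ∧ x + (-|t|) • u ∈ U := by
    rcases abs_choice t with h | h <;> rw [h]
    · exact ⟨h1, h2⟩
    · rw [neg_neg]; exact ⟨h2, h1⟩
  obtain ⟨ε, hε, hs⟩ := exists_segment_subset hU h3.1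
  obtain ⟨ε', hε', hs'⟩ := exists_segment_subset hU h3.2
  refine ⟨|t| + min ε ε', lt_add_of_pos_right _ (lt_min hε hε'), fun τ hτ => ?_⟩
  have hm : 0 < min ε ε' := lt_min hε hε'
  rw [sub_zero] at hτ
  have ha := hs (|t| + min ε ε') (by
    rw [add_sub_cancel_left, abs_of_pos hm]; exact min_le_left _ _)
  have hb := hs' (-(|t| + min ε ε')) (by
    rw [show -(|t| + min ε ε') - -|t| = -min ε ε' by ring, abs_neg, abs_of_pos hm]
    exact min_le_right _ _)
  exact hord.out hb ha (abs_le.1 hτ)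

variable {φ : ℝ → ℝ}

/-- Points of `x + ℝ u` reached by moving the segments of `U` parallel to `u` by `φ`. -/
def IsReached (u : Euc n) (φ : ℝ → ℝ) (U : Set (Euc n)) (y : Euc n) : Prop :=
  ∃ x ∈ hyperplane u, ∃ m h s : ℝ, |s| < h ∧ y = x + (φ m + s) • u ∧
    ∀ τ, |τ - m| ≤ h → x + τ • u ∈ U

theorem isReached_of_mem (hU : IsOpen U) {x : Euc n} (hx : x ∈ hyperplane u) {t : ℝ}
    (h : x + t • u ∈ U) : IsReached u φ U (x + φ t • u) := by
  obtain ⟨ε, hε, hs⟩ := exists_segment_subset hU h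
  exact ⟨x, hx, t, ε, 0, by simpa using hε, by simp, hs⟩

/-- A short segment around the point might be carried to the mirror side, as when `φ t = |t|`. A
long segment centred on `H` keeps its midpoint and so covers both the point and its mirror image. -/
theorem isReached_of_symm_mem (hU : IsOpen U) (hc : Convex ℝ U) (hφ : φ 0 = 0) {x : Euc n}
    (hx : x ∈ hyperplane u) {t : ℝ} (h1 : x + t • u ∈ U) (h2 : x + (-t) • u ∈ U) :
    IsReached u φ U (x + t • u) := by
  obtain ⟨h, hth, hs⟩ := exists_symm_segment_subset hU hc h1 h2
  exact ⟨x, hx, 0, h, t, hth, by rw [hφ, zero_add], hs⟩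

theorem reflection_add_smul (hu : ‖u‖ = 1) {x : Euc n} (hx : x ∈ hyperplane u) (t : ℝ) :
    (hyperplane u).reflection (x + t • u) = x + (-t) • u := by
  rw [reflection_hyperplane_apply hu, inner_add_smul hu hx]
  module

theorem exists_eq_add_smul (hu : ‖u‖ = 1) (y : Euc n) :
    ∃ x ∈ hyperplane u, ∃ t : ℝ, y = x + t • u :=
  ⟨_, perpPart_mem hu y, _, (perpPart_add_smul u y).symm⟩

theorem isReached_of_mem_polarizeSet (hu : ‖u‖ = 1) (hU : IsOpen U) (hc : Convex ℝ U)
    (hφ : ∀ t, φ t = |t|) {y : Euc n} (hy : y ∈ polarizeSet u U) : IsReached u φ U y := by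
  obtain ⟨x, hx, t, rfl⟩ := exists_eq_add_smul hu y
  rw [mem_polarizeSet_iff, reflection_add_smul hu hx, inner_add_smul hu hx] at hy
  rcases hy with ⟨ht, h | h⟩ | ⟨-, h1, h2⟩
  · have := isReached_of_mem (φ := φ) hU hx h
    rwa [hφ, abs_of_nonneg ht] at this
  · have := isReached_of_mem (φ := φ) hU hx h
    rwa [hφ, abs_neg, abs_of_nonneg ht] at this
  · exact isReached_of_symm_mem hU hc (by rw [hφ, abs_zero]) hx h1 h2

theorem isReached_of_mem_reflectSet_polarizeSet (hu : ‖u‖ = 1) (hU : IsOpen U) (hc : Convex ℝ U)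
    (hφ : ∀ t, φ t = -|t|) {y : Euc n} (hy : y ∈ reflectSet (hyperplane u) (polarizeSet u U)) :
    IsReached u φ U y := by
  obtain ⟨x, hx, t, rfl⟩ := exists_eq_add_smul hu y
  rw [reflectSet_eq_preimage, mem_preimage, mem_polarizeSet_iff, reflection_add_smul hu hx,
    inner_add_smul hu hx, reflection_add_smul hu hx, neg_neg] at hy
  rcases hy with ⟨ht, h | h⟩ | ⟨-, h1, h2⟩
  · have := isReached_of_mem (φ := φ) hU hx h
    rwa [hφ, abs_of_nonneg ht, neg_neg] at this
  · have := isReached_of_mem (φ := φ) hU hx h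
    rwa [hφ, abs_of_nonpos (neg_nonneg.1 ht), neg_neg] at this
  · exact isReached_of_symm_mem hU hc (by rw [hφ, abs_zero, neg_zero]) hx h2 h1

theorem isReached_of_mem_reflectSet (hu : ‖u‖ = 1) (hU : IsOpen U) (hφ : ∀ t, φ t = -t)
    {y : Euc n} (hy : y ∈ reflectSet (hyperplane u) U) : IsReached u φ U y := by
  obtain ⟨x, hx, t, rfl⟩ := exists_eq_add_smul hu y
  rw [reflectSet_eq_preimage, mem_preimage, reflection_add_smul hu hx] at hy
  have := isReached_of_mem (φ := φ) hU hx hy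
  rwa [hφ, neg_neg] at this

theorem isReached_of_mem_self (hu : ‖u‖ = 1) (hU : IsOpen U) (hφ : ∀ t, φ t = t)
    {y : Euc n} (hy : y ∈ U) : IsReached u φ U y := by
  obtain ⟨x, hx, t, rfl⟩ := exists_eq_add_smul hu y
  have := isReached_of_mem (φ := φ) hU hx hy
  rwa [hφ] at this

end Segments

/-! ### From shift functions to set maps and back. -/

section Characterization

variable {n : ℕ} {u : Euc n} {𝓔 : Set (Set (Euc n))} {D : 𝓔 → finiteMeasureSets n} {φ : ℝ → ℝ}

/-- A set map that respects null sets, does not decrease volume and moves the segments parallel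
to `u` as `φ` prescribes agrees with `D`. -/
theorem essentiallyEquals_of_isReached (hn : n ≠ 0) (hu : ‖u‖ = 1) (h𝓔 : convexBodies n ⊆ 𝓔)
    (h𝓔' : 𝓔 ⊆ compactConvexSets n)
    (hmono : IsMonotonic D) (hmeas : IsMeasurePreserving D)
    (hcyl : RespectsCylinders (hyperplane u) D) (hφ : IsShiftFunction u D φ)
    (F : Set (Euc n) → Set (Euc n))
    (hF : ∀ A B : Set (Euc n), A =ᵐ[volume] B → F A =ᵐ[volume] F B)
    (hFm : ∀ A, MeasurableSet A → MeasurableSet (F A))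
    (hFv : ∀ A, MeasurableSet A → volume A ≤ volume (F A))
    (hFr : ∀ U, IsOpen U → Convex ℝ U → ∀ y ∈ F U, IsReached u φ U y) :
    EssentiallyEquals D F := by
  intro K
  -- Convex sets have null frontier. If the interior is empty, `K` itself is null, so
  -- lower-dimensional sets need no separate case.
  have hKi : interior (K : Set (Euc n)) =ᵐ[volume] (K : Set (Euc n)) :=
    interior_ae_eq_of_null_frontier ((h𝓔' K.2).2.2.addHaar_frontier volume)
  refine (image_ae_eq_of_segments hn hu h𝓔 hmono hmeas hcyl hφ K
    (hFm _ isOpen_interior.measurableSet).nullMeasurableSet ?_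
    (hFr _ isOpen_interior (h𝓔' K.2).2.2.interior)).trans (hF _ _ hKi)
  rw [← measure_congr hKi]
  exact hFv _ isOpen_interior.measurableSet

/-- The shift function is read off from the images of the balls centred on `ℝ u`. -/
theorem shiftFunction_eq_of_essentiallyEquals (hu : ‖u‖ = 1) (h𝓔 : convexBodies n ⊆ 𝓔)
    (hφ : IsShiftFunction u D φ) {F : Set (Euc n) → Set (Euc n)} {ψ : ℝ → ℝ}
    (hF : ∀ t, F (closedBall (t • u) 1) = closedBall (ψ t • u) 1) (h : EssentiallyEquals D F)
    (t : ℝ) : φ t = ψ t := by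
  have hu0 : u ≠ 0 := by rintro rfl; simp at hu
  have : Nontrivial (Euc n) := ⟨u, 0, hu0⟩
  have hB : closedBall (t • u) 1 ∈ 𝓔 := h𝓔 (closedBall_mem_convexBodies _ one_pos)
  have h1 := hφ.2 ⟨_, hB⟩ 0 t 1 (Submodule.zero_mem _) one_pos (by simp)
  have h2 := h ⟨_, hB⟩
  rw [hF] at h2
  have h3 := eq_of_closedBall_ae_eq one_pos (h1.symm.trans h2)
  rw [zero_add] at h3
  exact smul_left_injective ℝ hu0 h3

end Characterization

end Polarization

/-! ### The main theorem: the four set maps as instances. -/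

theorem mainTheorem9 (n : ℕ) (hn : 2 ≤ n)
    (u : Polarization.Euc n) (hu : ‖u‖ = 1)
    (𝓔 : Set (Set (Polarization.Euc n)))
    (h𝓔 : 𝓔 = Polarization.convexBodies n ∨ 𝓔 = Polarization.compactConvexSets n)
    (D : 𝓔 → Polarization.finiteMeasureSets n)
    (hmono : Polarization.IsMonotonic D)
    (hmeas : Polarization.IsMeasurePreserving D)
    (hcyl : Polarization.RespectsCylinders (Polarization.hyperplane u) D)
    (hball : Polarization.MapsBallsToBalls D) :
    (∃! φ : ℝ → ℝ, Polarization.IsShiftFunction u D φ) ∧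
    ∀ φ : ℝ → ℝ, Polarization.IsShiftFunction u D φ →
      ((∀ t, φ t = t) ↔ Polarization.EssentiallyEquals D id) ∧
      ((∀ t, φ t = -t) ↔
        Polarization.EssentiallyEquals D
          (Polarization.reflectSet (Polarization.hyperplane u))) ∧
      ((∀ t, φ t = |t|) ↔ Polarization.EssentiallyEquals D (Polarization.polarizeSet u)) ∧
      ((∀ t, φ t = -|t|) ↔
        Polarization.EssentiallyEquals D
          (fun K => Polarization.reflectSet (Polarization.hyperplane u)
            (Polarization.polarizeSet u K))) := by
  have hn0 : n ≠ 0 := by omega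
  have hsub : Polarization.convexBodies n ⊆ 𝓔 := by
    rcases h𝓔 with rfl | rfl
    · exact subset_rfl
    · exact fun K hK => hK.1
  have hsub' : 𝓔 ⊆ Polarization.compactConvexSets n := by
    rcases h𝓔 with rfl | rfl
    · exact fun K hK => hK.1
    · exact subset_rfl
  refine ⟨Polarization.existsUnique_shiftFunction hn hu hsub hmono hmeas hcyl hball,
    fun φ hφ => ?_⟩
  have main := Polarization.essentiallyEquals_of_isReached hn0 hu hsub hsub' hmono hmeas hcyl hφ
  have hmr : ∀ A : Set (Polarization.Euc n), MeasurableSet A →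
      MeasurableSet (Polarization.reflectSet (Polarization.hyperplane u) A) := by
    intro A hA
    rw [Polarization.reflectSet_eq_preimage]
    exact (Polarization.hyperplane u).reflection.continuous.measurable hA
  have hvr : ∀ A : Set (Polarization.Euc n), MeasurableSet A →
      MeasureTheory.volume (Polarization.reflectSet (Polarization.hyperplane u) A) =
        MeasureTheory.volume A := by
    intro A hA
    rw [Polarization.reflectSet_eq_preimage, Polarization.volume_reflection_preimage _ hA]
  refine ⟨⟨fun h => ?_, fun h => ?_⟩, ⟨fun h => ?_, fun h => ?_⟩, ⟨fun h => ?_, fun h => ?_⟩,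
    ⟨fun h => ?_, fun h => ?_⟩⟩
  · exact main id (fun _ _ h => h) (fun _ h => h) (fun _ _ => le_rfl)
      fun U hU _ y hy => Polarization.isReached_of_mem_self hu hU h hy
  · exact Polarization.shiftFunction_eq_of_essentiallyEquals hu hsub hφ (fun _ => rfl) h
  · exact main _ (fun _ _ h => Polarization.reflectSet_congr_ae _ h) hmr
      (fun A hA => (hvr A hA).ge)
      fun U hU _ y hy => Polarization.isReached_of_mem_reflectSet hu hU h hy
  · exact Polarization.shiftFunction_eq_of_essentiallyEquals hu hsub hφ
      (fun t => Polarization.reflectSet_closedBall hu t 1) h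
  · exact main _ (fun _ _ h => Polarization.polarizeSet_congr_ae h)
      (fun _ hA => Polarization.measurableSet_polarizeSet hA)
      (fun _ hA => Polarization.volume_le_volume_polarizeSet hu hA)
      fun U hU hc y hy => Polarization.isReached_of_mem_polarizeSet hu hU hc h hy
  · exact Polarization.shiftFunction_eq_of_essentiallyEquals hu hsub hφ
      (fun t => Polarization.polarizeSet_closedBall hu t 1) h
  · exact main _ (fun _ _ h => Polarization.reflectSet_congr_ae _
        (Polarization.polarizeSet_congr_ae h))
      (fun A hA => hmr _ (Polarization.measurableSet_polarizeSet hA))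
      (fun A hA => (Polarization.volume_le_volume_polarizeSet hu hA).trans
        (hvr _ (Polarization.measurableSet_polarizeSet hA)).ge)
      fun U hU hc y hy => Polarization.isReached_of_mem_reflectSet_polarizeSet hu hU hc h hy
  · refine Polarization.shiftFunction_eq_of_essentiallyEquals hu hsub hφ (fun t => ?_) h
    rw [Polarization.polarizeSet_closedBall hu, Polarization.reflectSet_closedBall hu]
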